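/- A star edge-coloring of a finite simple graph $G$ is a proper edge-coloring of $G$ (adjacent edges receive distinct colors) such that no path with four edges and no cycle with four edges in $G$ is bi-colored, i.e. has at most two colors on its edges. The star chromatic index $\chi'_s(G)$ is the smallest integer $k$ such that $G$ admits a star edge-coloring with colors from a set of $k$ elements. The star chromatic index of the complete graph $K_n$ satisfies, for $n \ge 2$, $$\chi'_s(K_n) \le n \cdot \frac{2^{2\sqrt2\,(1+o(1))\sqrt{\log_2 n}}}{(\log_2 n)^{1/4}},$$ where $o(1)$ denotes a function of $n$ that tends to $0$ as $n\to\infty$. In particular, for every $\varepsilon>0$ there exists a constant $c$ (depending only on $\varepsilon$) such that $\chi'_s(K_n) \le c\, n^{1+\varepsilon}$ for every $n\ge 1$. -/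

import Mathlib

open Filter Topology

namespace StarEdge

variable {V C : Type*} {G : SimpleGraph V}

/-- A subgraph `F` of `G` is bi-colored under the edge-coloring `φ` if at most two colors
occur on the edges of `F`. -/
def IsBicolored (φ : G.edgeSet → C) (F : G.Subgraph) : Prop :=
  (φ '' {e : G.edgeSet | (e : Sym2 V) ∈ F.edgeSet}).encard ≤ 2

/-- A star edge-coloring: adjacent edges (distinct edges with a common end) receive distinct
colors, and there are neither bi-colored paths of length four nor bi-colored 4-cycles
(the length is the number of edges). -/
structure IsStarEdgeColoring (φ : G.edgeSet → C) : Prop where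
  proper : ∀ e f : G.edgeSet, G.lineGraph.Adj e f → φ e ≠ φ f
  path : ∀ (u v : V) (p : G.Walk u v), p.IsPath → p.length = 4 → ¬ IsBicolored φ p.toSubgraph
  cycle : ∀ (v : V) (p : G.Walk v v), p.IsCycle → p.length = 4 → ¬ IsBicolored φ p.toSubgraph

/-- `G` admits a star edge-coloring whose colors come from a set of cardinality `k`. -/
def StarEdgeColorable (G : SimpleGraph V) (k : ℕ) : Prop :=
  ∃ φ : G.edgeSet → Fin k, IsStarEdgeColoring φ

/-- The star chromatic index of a finite graph: the least `k` such that `G` admits a star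
`k`-edge-coloring. Such a `k` exists, see `exists_starEdgeColorable`. -/
noncomputable def starChromaticIndex {V : Type*} [Finite V] (G : SimpleGraph V) : ℕ :=
  sInf {k : ℕ | StarEdgeColorable G k}

theorem not_isBicolored_of_injective {φ : G.edgeSet → C} (hφ : Function.Injective φ)
    {u v : V} (p : G.Walk u v) (hp : p.IsTrail) (h4 : p.length = 4) :
    ¬ IsBicolored φ p.toSubgraph := by
  classical
  intro h
  unfold IsBicolored at h
  rw [hφ.encard_image, ← Subtype.val_injective.encard_image] at h
  have hs : (Subtype.val '' {e : G.edgeSet | (e : Sym2 V) ∈ p.toSubgraph.edgeSet})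
      = (p.edges.toFinset : Set (Sym2 V)) := by
    ext e
    simp only [Set.mem_image, Set.mem_ofPred_eq, SimpleGraph.Walk.mem_edges_toSubgraph,
      List.coe_toFinset]
    constructor
    · rintro ⟨e, he, rfl⟩
      exact he
    · intro he
      exact ⟨⟨e, p.edges_subset_edgeSet he⟩, he, rfl⟩
  rw [hs, Set.encard_coe_eq_coe_finsetCard, List.toFinset_card_of_nodup hp.edges_nodup,
    SimpleGraph.Walk.length_edges, h4] at h
  exact absurd h (by decide)

/-- Every finite graph has a star edge-coloring with finitely many colors, so that the star
chromatic index is a minimum over a nonempty set. -/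
theorem exists_starEdgeColorable [Finite V] (G : SimpleGraph V) :
    ∃ k : ℕ, StarEdgeColorable G k := by
  obtain ⟨k, ⟨e⟩⟩ := Finite.exists_equiv_fin G.edgeSet
  refine ⟨k, e, ⟨fun a b hab h => hab.ne (e.injective h), fun u v p hp h4 => ?_,
    fun v p hp h4 => ?_⟩⟩
  · exact not_isBicolored_of_injective e.injective p hp.isTrail h4
  · exact not_isBicolored_of_injective e.injective p hp.isCircuit.isTrail h4

end StarEdge

/-!
Give the vertices distinct integer labels `a v` below `N` from a set without three-term arithmetic
progressions, and color the edge `uv` by `a u + a v`, which takes fewer than `2 * N` values. The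
coloring is proper since the labels are distinct. If a trail `v₀ v₁ v₂ v₃ v₄` were bi-colored, its
colors would alternate, so `a v₀ + a v₁ = a v₂ + a v₃` and `a v₁ + a v₂ = a v₃ + a v₄`;
subtracting, `a v₀ + a v₄ = 2 * a v₂`, so `v₀ = v₂`, which is impossible. This treats paths and
4-cycles at once. Hence the star chromatic index of a graph on `n` vertices is at most `2 * N` as
soon as `n ≤ rothNumberNat N` (`starChromaticIndex_le_of_le_rothNumberNat`).

Behrend's construction in dimension `d` yields such an `N` of size about `2 ^ d * n ^ (1 + 2 / d)`.
With `L = log₂ n`, the choice `d ≈ √(2 L)` balances `d` against `2 L / d` and gives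
`N = n * 2 ^ (2√2 √L + O(log L))`. Mathlib's final form `Behrend.roth_lower_bound` has a worse
constant in the exponent, so the optimization is redone from `Behrend.bound_aux`
(`starChromaticIndex_mul_rpow_le`). The factor `L ^ (1 / 4)` is absorbed by the error `O(log L)`,
which is `o(√L)`.
-/

/-! ### Coloring edges by sums of progression-free labels -/

/-- In a set with at most two elements, an element different from `y` is determined. -/
theorem Set.eq_of_encard_le_two {α : Type*} {s : Set α} (hs : s.encard ≤ 2) {x y z : α}
    (hx : x ∈ s) (hy : y ∈ s) (hz : z ∈ s) (hxy : x ≠ y) (hyz : y ≠ z) : x = z := by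
  by_contra hxz
  have h3 : ({x, y, z} : Set α).encard = 3 :=
    Set.encard_eq_three.2 ⟨x, y, z, hxy, hxz, hyz, rfl⟩
  have h := (Set.encard_le_encard (show ({x, y, z} : Set α) ⊆ s by
    rintro w (rfl | rfl | rfl) <;> assumption)).trans hs
  rw [h3] at h
  exact absurd h (by decide)

namespace StarEdge

/-- If the vertices carry distinct labels below `N` that form a 3AP-free set, then coloring each
edge by the sum of the labels of its ends is a star edge-coloring, whatever the graph. -/
theorem StarEdgeColorable.of_threeAPFree {V : Type*} (G : SimpleGraph V) {N : ℕ} {a : V → ℕ}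
    (ha : Function.Injective a) (haN : ∀ v, a v < N) (hfree : ThreeAPFree (Set.range a)) :
    StarEdgeColorable G (2 * N) := by
  have hlt (e : Sym2 V) : (e.map a).add < 2 * N := by
    induction e with
    | _ u v =>
      have hu := haN u
      have hv := haN v
      simp only [Sym2.map_mk, Sym2.add_mk]
      omega
  let φ : G.edgeSet → Fin (2 * N) := fun e => ⟨((e : Sym2 V).map a).add, hlt e⟩
  have hφ {u v w x : V} (h : G.Adj u v) (h' : G.Adj w x) :
      φ ⟨s(u, v), h⟩ = φ ⟨s(w, x), h'⟩ ↔ a u + a v = a w + a x := by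
    simp [φ]
  -- A trail of length four covers both a path and a 4-cycle.
  have key (u v : V) (p : G.Walk u v) (hp : p.IsTrail) (h4 : p.length = 4) :
      ¬ IsBicolored φ p.toSubgraph := by
    intro hbi
    match p, h4 with
    | .cons (v := v₁) h₁ (.cons (v := v₂) h₂ (.cons (v := v₃) h₃ (.cons h₄ .nil))), _ =>
      have h02 : u ≠ v₂ := by
        rintro rfl
        simp [Sym2.eq_swap] at hp
      have h13 : v₁ ≠ v₃ := by
        rintro rfl
        simp [Sym2.eq_swap] at hp
      have h24 : v₂ ≠ v := by
        rintro rfl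
        simp [Sym2.eq_swap] at hp
      have n12 : φ ⟨s(u, v₁), h₁⟩ ≠ φ ⟨s(v₁, v₂), h₂⟩ := fun h =>
        h02 (ha (by have := (hφ h₁ h₂).1 h; omega))
      have n23 : φ ⟨s(v₁, v₂), h₂⟩ ≠ φ ⟨s(v₂, v₃), h₃⟩ := fun h =>
        h13 (ha (by have := (hφ h₂ h₃).1 h; omega))
      have n34 : φ ⟨s(v₂, v₃), h₃⟩ ≠ φ ⟨s(v₃, v), h₄⟩ := fun h =>
        h24 (ha (by have := (hφ h₃ h₄).1 h; omega))
      have e13 := (hφ h₁ h₃).1 (Set.eq_of_encard_le_two hbi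
        ⟨_, by simp, rfl⟩ ⟨_, by simp, rfl⟩ ⟨_, by simp, rfl⟩ n12 n23)
      have e24 := (hφ h₂ h₄).1 (Set.eq_of_encard_le_two hbi
        ⟨_, by simp, rfl⟩ ⟨_, by simp, rfl⟩ ⟨_, by simp, rfl⟩ n23 n34)
      -- The labels of `u`, `v₂`, `v` form a three-term arithmetic progression.
      exact h02 (ha (hfree ⟨u, rfl⟩ ⟨v₂, rfl⟩ ⟨v, rfl⟩ (by omega)))
  refine ⟨φ, ⟨?_, fun u v p hp => key u v p hp.isTrail,
    fun v p hp => key v v p hp.isCircuit.isTrail⟩⟩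
  rintro ⟨e, he⟩ ⟨f, hf⟩ hadj
  obtain ⟨hne, v, hve, hvf⟩ := SimpleGraph.lineGraph_adj_iff_exists.1 hadj
  obtain ⟨x, rfl⟩ := hve
  obtain ⟨y, rfl⟩ := hvf
  intro h
  obtain rfl : x = y := ha (Nat.add_left_cancel ((hφ he hf).1 h))
  exact hne rfl

theorem starChromaticIndex_le_of_le_rothNumberNat {n N : ℕ} (G : SimpleGraph (Fin n))
    (h : n ≤ rothNumberNat N) : starChromaticIndex G ≤ 2 * N := by
  obtain ⟨t, htN, htcard, hfree⟩ := rothNumberNat_spec N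
  obtain ⟨s, hst, hs⟩ := Finset.exists_subset_card_eq (h.trans_eq htcard.symm)
  refine Nat.sInf_le (StarEdgeColorable.of_threeAPFree G (a := s.orderEmbOfFin hs)
    (s.orderEmbOfFin hs).injective
    (fun v => Finset.mem_range.1 (htN (hst (s.orderEmbOfFin_mem hs v)))) ?_)
  rw [Finset.range_orderEmbOfFin]
  exact hfree.mono (Finset.coe_subset.2 hst)

end StarEdge

/-! ### Optimizing Behrend's construction -/

namespace StarEdge

/-- Behrend's construction in dimension `k + 2` with digits below `⌈x⌉`, where `x` is chosen so
that it provides `n` labels. -/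
theorem starChromaticIndex_le_of_pow_eq {n k : ℕ} (G : SimpleGraph (Fin n)) {x : ℝ}
    (hx : (k : ℝ) + 2 ≤ x) (hxk : x ^ k = (k + 2) * n) :
    (starChromaticIndex G : ℝ) ≤ n * (2 ^ (k + 5) * (k + 2) * x ^ 2) := by
  have hk : (0 : ℝ) ≤ k := k.cast_nonneg
  have hx0 : 0 < x := by linarith
  set m := ⌈x⌉₊ with hm
  have hxm : x ≤ m := Nat.le_ceil x
  have hm0 : m ≠ 0 := by
    rintro h
    rw [h, Nat.cast_zero] at hxm
    linarith
  have hroth : n ≤ rothNumberNat ((2 * m - 1) ^ (k + 2)) := by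
    have h := Behrend.bound_aux hm0 (Nat.le_add_left 2 k)
    rw [Nat.add_sub_cancel] at h
    have h' : (n : ℝ) ≤ m ^ k / (k + 2 : ℕ) := by
      rw [le_div_iff₀ (by positivity)]
      calc (n : ℝ) * (k + 2 : ℕ) = x ^ k := by rw [hxk]; push_cast; ring
        _ ≤ m ^ k := by gcongr
    exact_mod_cast h'.trans h
  -- Rounding `x` up costs only a constant factor, because the exponent `k + 2` is at most `x`.
  have hpow : (m : ℝ) ^ (k + 2) ≤ 4 * x ^ (k + 2) := by
    have h1 : (m : ℝ) ≤ x * Real.exp (1 / x) := by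
      have := (Nat.ceil_lt_add_one hx0.le).le
      calc (m : ℝ) ≤ x + 1 := this
        _ = x * (1 / x + 1) := by field_simp; ring
        _ ≤ _ := by gcongr; exact Real.add_one_le_exp _
    calc (m : ℝ) ^ (k + 2) ≤ (x * Real.exp (1 / x)) ^ (k + 2) := by gcongr
      _ = Real.exp ((k + 2 : ℕ) * (1 / x)) * x ^ (k + 2) := by
        rw [Real.exp_nat_mul]; ring
      _ ≤ Real.exp 1 * x ^ (k + 2) := by
        gcongr
        rw [mul_one_div, div_le_one hx0]
        push_cast
        exact hx
      _ ≤ 4 * x ^ (k + 2) := by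
        gcongr
        linarith [Real.exp_one_lt_three]
  have hχ : starChromaticIndex G ≤ 2 * (2 * m) ^ (k + 2) :=
    (starChromaticIndex_le_of_le_rothNumberNat G hroth).trans (by gcongr; omega)
  calc (starChromaticIndex G : ℝ) ≤ 2 * (2 * m) ^ (k + 2) := by exact_mod_cast hχ
    _ = 2 ^ (k + 3) * (m : ℝ) ^ (k + 2) := by ring
    _ ≤ 2 ^ (k + 3) * (4 * x ^ (k + 2)) := by gcongr
    _ = 2 ^ (k + 5) * x ^ k * x ^ 2 := by ring
    _ = n * (2 ^ (k + 5) * (k + 2) * x ^ 2) := by rw [hxk]; ring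

/-- The bound for `n = 2 ^ L` in terms of `s = √(2 L)`, from Behrend's construction in dimension
`⌈s⌉ + 2`. The main term `2 * s` of the exponent is `2√2 * √L`. -/
theorem starChromaticIndex_mul_rpow_le {n : ℕ} (G : SimpleGraph (Fin n)) {L s : ℝ}
    (hn : (n : ℝ) = 2 ^ L) (hs1 : 1 ≤ s) (hsL : s ^ 2 = 2 * L) (hs : 12 + 4 * Real.logb 2 s ≤ s) :
    (starChromaticIndex G : ℝ) * L ^ ((1 : ℝ) / 4) ≤
      n * 2 ^ (2 * s + (12 + 4 * Real.logb 2 s)) := by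
  set l := Real.logb 2 s with hl
  have hs0 : 0 < s := by linarith
  have hsl : (2 : ℝ) ^ l = s := Real.rpow_logb (by norm_num) (by norm_num) hs0
  have hl0 : 0 ≤ l := Real.logb_nonneg (by norm_num) hs1
  have hL0 : 0 ≤ L := by nlinarith
  set k := ⌈s⌉₊ with hk
  have hsk : s ≤ k := Nat.le_ceil s
  have hks : (k : ℝ) ≤ s + 1 := (Nat.ceil_lt_add_one hs0.le).le
  have hk1 : (1 : ℝ) ≤ k := hs1.trans hsk
  have hk0 : (0 : ℝ) < k := by linarith
  set b := Real.logb 2 ((k : ℝ) + 2) with hb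
  have hbk : (2 : ℝ) ^ b = k + 2 := Real.rpow_logb (by norm_num) (by norm_num) (by linarith)
  have hb0 : 0 ≤ b := Real.logb_nonneg (by norm_num) (by linarith)
  have hbl : b ≤ 2 + l := by
    rw [← Real.rpow_le_rpow_left_iff (x := 2) (by norm_num), hbk, Real.rpow_add (by norm_num), hsl]
    norm_num
    linarith
  -- The solution `2 ^ y` of `x ^ k = (k + 2) * n`.
  set y := (L + b) / k with hy
  have hyk : y * k = L + b := div_mul_cancel₀ _ hk0.ne'
  have hy2 : 2 * y ≤ s + 2 * (2 + l) := by
    rw [← mul_le_mul_iff_left₀ hk0]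
    nlinarith
  have hby : b ≤ y := by
    refine hbl.trans ?_
    rw [← mul_le_mul_iff_left₀ hk0]
    nlinarith
  have h := starChromaticIndex_le_of_pow_eq G (k := k) (x := 2 ^ y)
    (by rw [← hbk]; exact Real.rpow_le_rpow_of_exponent_le (by norm_num) hby)
    (by rw [← Real.rpow_natCast, ← Real.rpow_mul (by norm_num), hyk, Real.rpow_add (by norm_num),
      hbk, hn, mul_comm])
  have hLs : L ^ ((1 : ℝ) / 4) ≤ 2 ^ l := by
    rw [hsl]
    calc L ^ ((1 : ℝ) / 4) ≤ (s ^ 4) ^ ((1 : ℝ) / 4) := by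
          gcongr
          nlinarith [pow_le_pow_right₀ hs1 (show 2 ≤ 4 by norm_num)]
      _ = s := by
        rw [← Real.rpow_natCast, ← Real.rpow_mul hs0.le]
        norm_num
  calc (starChromaticIndex G : ℝ) * L ^ ((1 : ℝ) / 4)
      ≤ n * (2 ^ (k + 5) * (k + 2) * (2 ^ y) ^ 2) * 2 ^ l := by gcongr
    _ = n * 2 ^ ((k + 5) + b + y * 2 + l) := by
      rw [Real.rpow_add (by norm_num), Real.rpow_add (by norm_num), Real.rpow_add (by norm_num),
        hbk, Real.rpow_mul (by norm_num)]
      norm_cast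
      ring
    _ ≤ _ := by
      refine mul_le_mul_of_nonneg_left
        (Real.rpow_le_rpow_of_exponent_le (by norm_num) ?_) n.cast_nonneg
      linarith

end StarEdge

/-! ### Asymptotics -/

namespace StarEdge

theorem eventually_rpow_div_le_rpow {δ : ℕ → ℝ} (hδ : Tendsto δ atTop (𝓝 0)) {c ε : ℝ}
    (hε : 0 < ε) : ∀ᶠ n : ℕ in atTop,
      (2 : ℝ) ^ (c * (1 + δ n) * √(Real.logb 2 n)) / (Real.logb 2 n) ^ ((1 : ℝ) / 4) ≤
        (n : ℝ) ^ ε := by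
  have hL : Tendsto (fun n : ℕ => Real.logb 2 n) atTop atTop :=
    (Real.tendsto_logb_atTop (by norm_num)).comp tendsto_natCast_atTop_atTop
  have hr : Tendsto (fun n : ℕ => √(Real.logb 2 n)) atTop atTop := Real.tendsto_sqrt_atTop.comp hL
  have h0 : Tendsto (fun n : ℕ => c * (1 + δ n) / √(Real.logb 2 n)) atTop (𝓝 0) :=
    ((hδ.const_add 1).const_mul c).div_atTop hr
  filter_upwards [h0.eventually_le_const hε, hL.eventually_ge_atTop 1, eventually_gt_atTop 0]
    with n h1 h2 h3
  have h4 : 0 < √(Real.logb 2 n) := Real.sqrt_pos.2 (by linarith)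
  have h5 : (n : ℝ) ^ ε = 2 ^ (Real.logb 2 n * ε) := by
    rw [Real.rpow_mul (by norm_num), Real.rpow_logb (by norm_num) (by norm_num) (by positivity)]
  refine (div_le_self (by positivity) (Real.one_le_rpow h2 (by norm_num))).trans ?_
  rw [h5]
  refine Real.rpow_le_rpow_of_exponent_le (by norm_num) ?_
  rw [div_le_iff₀ h4] at h1
  calc c * (1 + δ n) * √(Real.logb 2 n)
      ≤ ε * √(Real.logb 2 n) * √(Real.logb 2 n) := by gcongr
    _ = Real.logb 2 n * ε := by
      rw [mul_assoc, Real.mul_self_sqrt (by linarith), mul_comm]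

/-- The error term of the exponent is negligible against `s`. -/
theorem tendsto_twelve_add_logb_div :
    Tendsto (fun s : ℝ => (12 + 4 * Real.logb 2 s) / s) atTop (𝓝 0) := by
  have h1 : Tendsto (fun s : ℝ => Real.log s / s) atTop (𝓝 0) :=
    Real.isLittleO_log_id_atTop.tendsto_div_nhds_zero
  have h2 : Tendsto (fun s : ℝ => 12 / s) atTop (𝓝 0) := tendsto_id.const_div_atTop 12
  have h := h2.add (h1.const_mul (4 / Real.log 2))
  rw [mul_zero, add_zero] at h
  refine h.congr fun s => ?_
  rw [Real.logb]
  ring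

end StarEdge

theorem theorem1 :
    (∃ δ : ℕ → ℝ, Tendsto δ atTop (𝓝 0) ∧
      ∀ n : ℕ, 2 ≤ n →
        (StarEdge.starChromaticIndex (⊤ : SimpleGraph (Fin n)) : ℝ) ≤
          (n : ℝ) * ((2 : ℝ) ^ (2 * √2 * (1 + δ n) * √(Real.logb 2 (n : ℝ))) /
            (Real.logb 2 (n : ℝ)) ^ ((1 : ℝ) / 4))) ∧
    (∀ ε : ℝ, 0 < ε → ∃ c : ℝ, ∀ n : ℕ, 1 ≤ n →
      (StarEdge.starChromaticIndex (⊤ : SimpleGraph (Fin n)) : ℝ) ≤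
        c * (n : ℝ) ^ (1 + ε)) := by
  rw [← exists_and_right]
  let L (n : ℕ) : ℝ := Real.logb 2 n
  let s (n : ℕ) : ℝ := √2 * √(L n)
  have hs : Tendsto s atTop atTop :=
    (Real.tendsto_sqrt_atTop.comp ((Real.tendsto_logb_atTop (by norm_num)).comp
      tendsto_natCast_atTop_atTop)).const_mul_atTop (by positivity)
  -- For each single `n` any bound holds once `δ n` is large enough.
  have hsmall (n : ℕ) : ∃ d : ℝ, 2 ≤ n →
      (StarEdge.starChromaticIndex (⊤ : SimpleGraph (Fin n)) : ℝ) ≤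
        n * ((2 : ℝ) ^ (2 * √2 * (1 + d) * √(L n)) / (L n) ^ ((1 : ℝ) / 4)) := by
    by_cases hn : 2 ≤ n
    · have hL : 0 < L n := Real.logb_pos (by norm_num) (by exact_mod_cast hn)
      set A : ℝ := StarEdge.starChromaticIndex (⊤ : SimpleGraph (Fin n)) * (L n) ^ ((1 : ℝ) / 4) / n
        with hA
      have hA0 : 0 ≤ A := by positivity
      refine ⟨Real.logb 2 (A + 1) / (2 * √2 * √(L n)) - 1, fun _ => ?_⟩
      have he : 2 * √2 * (1 + (Real.logb 2 (A + 1) / (2 * √2 * √(L n)) - 1)) * √(L n) =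
          Real.logb 2 (A + 1) := by
        have := Real.sqrt_pos.2 hL
        field_simp
        ring
      rw [he, Real.rpow_logb (by norm_num) (by norm_num) (by positivity), ← mul_div_assoc,
        le_div_iff₀ (by positivity), mul_comm (n : ℝ), ← div_le_iff₀ (by positivity)]
      exact (lt_add_one A).le
    · exact ⟨0, fun h => absurd h hn⟩
  choose d hd using hsmall
  -- Half the relative error of the exponent, since its main term is `2 * s n`.
  let δ (n : ℕ) : ℝ := if 1 ≤ s n ∧ (12 + 4 * Real.logb 2 (s n)) / s n ≤ 1 then
    (12 + 4 * Real.logb 2 (s n)) / s n / 2 else d n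
  have hδ : Tendsto δ atTop (𝓝 0) := by
    have h := StarEdge.tendsto_twelve_add_logb_div.comp hs
    have h' := h.div_const 2
    rw [zero_div] at h'
    refine h'.congr' ?_
    filter_upwards [hs.eventually_ge_atTop 1, h.eventually_le_const one_pos] with n h1 h2
    exact (if_pos ⟨h1, h2⟩).symm
  have hbound (n : ℕ) (hn : 2 ≤ n) :
      (StarEdge.starChromaticIndex (⊤ : SimpleGraph (Fin n)) : ℝ) ≤
        n * ((2 : ℝ) ^ (2 * √2 * (1 + δ n) * √(L n)) / (L n) ^ ((1 : ℝ) / 4)) := by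
    by_cases h : 1 ≤ s n ∧ (12 + 4 * Real.logb 2 (s n)) / s n ≤ 1
    · have hL : 0 < L n := Real.logb_pos (by norm_num) (by exact_mod_cast hn)
      have hs0 : 0 < s n := by linarith [h.1]
      have he : 2 * √2 * (1 + δ n) * √(L n) = 2 * s n + (12 + 4 * Real.logb 2 (s n)) := by
        rw [show δ n = (12 + 4 * Real.logb 2 (s n)) / s n / 2 from if_pos h]
        calc _ = 2 * (1 + (12 + 4 * Real.logb 2 (s n)) / s n / 2) * s n := by
              simp only [s]; ring
          _ = _ := by field_simp
      rw [he, ← mul_div_assoc, le_div_iff₀ (by positivity)]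
      refine StarEdge.starChromaticIndex_mul_rpow_le _ ?_ h.1 ?_ ((div_le_one hs0).1 h.2)
      · exact (Real.rpow_logb (by norm_num) (by norm_num) (by positivity)).symm
      · rw [mul_pow, Real.sq_sqrt (by norm_num), Real.sq_sqrt hL.le]
    · rw [show δ n = d n from if_neg h]
      exact hd n hn
  -- A bound for large `n` gives one for all `n ≥ 1`, as finitely many values only change `c`.
  refine ⟨δ, ⟨hδ, hbound⟩, fun ε hε => ?_⟩
  have hO : (fun n : ℕ => (StarEdge.starChromaticIndex (⊤ : SimpleGraph (Fin n)) : ℝ)) =O[atTop]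
      fun n : ℕ => (n : ℝ) ^ (1 + ε) := by
    refine Asymptotics.IsBigO.of_bound 1 ?_
    filter_upwards [StarEdge.eventually_rpow_div_le_rpow hδ (c := 2 * √2) hε,
      eventually_ge_atTop 2] with n h1 h2
    rw [one_mul, Real.norm_of_nonneg (by positivity), Real.norm_of_nonneg (by positivity),
      Real.rpow_add (by positivity), Real.rpow_one]
    exact (hbound n h2).trans (by gcongr)
  obtain ⟨c, -, hc⟩ := Asymptotics.bound_of_isBigO_nat_atTop hO
  refine ⟨c, fun n hn => ?_⟩
  have hn0 : (0 : ℝ) < n := by exact_mod_cast hn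
  have h := hc (x := n) (by positivity)
  rwa [Real.norm_of_nonneg (by positivity), Real.norm_of_nonneg (by positivity)] at h
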